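/- Let $\mathcal{D}$ be the collection of all dyadic intervals $[k2^{-j},(k+1)2^{-j})$ $(j,k\in\mathbb{Z})$ contained in $[0,1)$, and let $|\cdot|$ denote Lebesgue measure. A collection $\mathcal{S}\subseteq\mathcal{D}$ is called sparse if for every $J\in\mathcal{S}$ there is a measurable subset $E(J)\subseteq J$ with $|E(J)|\ge\frac12|J|$ such that the sets $E(J)$, $J\in\mathcal{S}$, are pairwise disjoint. For such $\mathcal{S}$ and a measurable set $E\subseteq[0,1)$ put $$\mathcal{A}_{\mathcal{S}}\mathbf{1}_E(t)=\sum_{J\in\mathcal{S}}\frac{|E\cap J|}{|J|}\,\mathbf{1}_J(t)\in[0,\infty].$$ Let $n\ge 0$ be an integer, and let $\lambda\ge 2$ be a real number of the form $\lambda=N-2^{-n}$ with $N\in\mathbb{N}$. Then for every sparse collection $\mathcal{S}\subseteq\mathcal{D}$ and every measurable $E\subseteq[0,1)$ with $|E|=2^{-n}$, $$\big|\{t\in[0,1):\ \mathcal{A}_{\mathcal{S}}\mathbf{1}_E(t)\ge\lambda\}\big|\le |E|\,2^{3-|E|-\lambda}.$$ Moreover, for every such $n$ and $\lambda$ there exist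 a sparse collection $\mathcal{S}\subseteq\mathcal{D}$ and a measurable set $E\subseteq[0,1)$ with $|E|=2^{-n}$ for which equality holds. -/

import Mathlib

open Set MeasureTheory

/-- `J` is a dyadic interval `[k 2^{-j}, (k+1) 2^{-j})` with `j, k ∈ ℤ`. -/
def IsDyadicInterval (J : Set ℝ) : Prop :=
  ∃ j k : ℤ, J = Ico ((k : ℝ) * (2 : ℝ) ^ (-j)) (((k : ℝ) + 1) * (2 : ℝ) ^ (-j))

/-- `𝒟(I)`: the collection of all dyadic intervals contained in `I`. -/
def dyadicSubintervals (I : Set ℝ) : Set (Set ℝ) :=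
  {J | IsDyadicInterval J ∧ J ⊆ I}

/-- A collection `S` of measurable sets is sparse if every `J ∈ S` has a (measurable) subset `F J`
with `|F J| ≥ |J| / 2` such that the sets `F J`, `J ∈ S`, are pairwise disjoint. -/
def IsSparse (S : Set (Set ℝ)) : Prop :=
  (∀ J ∈ S, MeasurableSet J) ∧
    ∃ F : Set ℝ → Set ℝ,
      (∀ J ∈ S, F J ⊆ J ∧ MeasurableSet (F J) ∧ volume J / 2 ≤ volume (F J)) ∧
        S.PairwiseDisjoint F

/-- The positive sparse operator `𝒜_S f = ∑_{J ∈ S} ⟨|f|⟩_J 1_J`, as a function with values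
in `[0, ∞]`, where `⟨|f|⟩_J` is the average of `|f|` over `J`. -/
noncomputable def sparseOperator (S : Set (Set ℝ)) (f : ℝ → ℝ) (t : ℝ) : ENNReal :=
  ∑' J : S, (J : Set ℝ).indicator (fun _ => ⨍⁻ s in (J : Set ℝ), ‖f s‖ₑ ∂volume) t

/-- The level set `{t ∈ [0,1) : 𝒜_S 1_E (t) ≥ lam}` (used for `lam ≥ 0`). -/
noncomputable def sparseLevelSet (S : Set (Set ℝ)) (E : Set ℝ) (lam : ℝ) : Set ℝ :=
  {t ∈ Ico (0 : ℝ) 1 | ENNReal.ofReal lam ≤ sparseOperator S (E.indicator fun _ => (1 : ℝ)) t}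

/-! ### The Bellman majorant -/

/-! The upper bound is a Bellman function argument. To a dyadic interval `I` attach the density `x`
of `E` in `I` and the Carleson mass `A`, the normalised total length of the members of `S` inside
`I`; sparseness forces `A ≤ 2`. A function `M(x, A, λ)` dominates the normalised level set once it
has three properties: it is at least `1` for `λ ≤ 0` and nonnegative otherwise; it is midpoint
concave in `(x, A)`, which handles passing to the two halves of `I` (`bellmanMajorant_midpoint`);
and `M(x, B, λ - x) ≤ M(x, B + 1, λ)` for `B ≤ 1`, which handles `I ∈ S`, where the operator gains
`x` and the mass gains `1` (`bellmanMajorant_jump`). Induction on the number of generations then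
gives `volume_truncatedSum_le`, and `M(x, A, λ) ≤ M(x, 2, λ) = x 2^(3-x-λ)` for `λ > 1` is the
claimed bound.

For `λ > 1` the choice is the `1`-homogeneous `x 2^(3-2x/A-λ)`, cut off at `2x = A`. While `2x ≤ 1`
the jump from `B = 1` to `2` is then an equality. A rational function bridges the range `0 < λ ≤ 1`.

For sharpness take `E = [0, 2^{-n})` and a tower of intervals shrinking to `0`, whose last
generation consists of both halves of its predecessor. The averages sum to `1 - 2^{-n}` above `E`,
and every later generation adds `1`. -/

lemma two_rpow_chord {a b s : ℝ} (hab : a < b) (ha : a ≤ s) (hb : s ≤ b) :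
    (2 : ℝ) ^ s * (b - a) ≤ (b - s) * 2 ^ a + (s - a) * 2 ^ b := by
  have hc : ConvexOn ℝ univ (fun x : ℝ => (2 : ℝ) ^ x) := by
    have := convexOn_exp.comp_linearMap (LinearMap.mul ℝ ℝ (Real.log 2))
    refine this.congr fun x _ => ?_
    simp [Real.rpow_def_of_pos]
  have hba : 0 < b - a := by linarith
  have this := hc.2 (mem_univ a) (mem_univ b) (div_nonneg (sub_nonneg.2 hb) hba.le)
    (div_nonneg (sub_nonneg.2 ha) hba.le) (by field_simp; ring)
  simp only [smul_eq_mul] at this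
  rw [show (b - s) / (b - a) * a + (s - a) / (b - a) * b = s by field_simp; ring] at this
  have h2 := mul_le_mul_of_nonneg_right this hba.le
  refine h2.trans_eq ?_
  field_simp

/-- The profile `u ↦ u 4^{-u}`, frozen at its value at `1/2` from there on. -/
noncomputable def bellmanProfile (u : ℝ) : ℝ := min u (1 / 2) * (2 : ℝ) ^ (-(2 * min u (1 / 2)))

lemma hasDerivAt_mul_two_rpow (u : ℝ) : HasDerivAt (fun u : ℝ => u * (2 : ℝ) ^ (-(2 * u)))
    ((1 - 2 * Real.log 2 * u) * (2 : ℝ) ^ (-(2 * u))) u := by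
  have h1 : HasDerivAt (fun u : ℝ => -(2 * u)) (-2) u := by
    exact ((hasDerivAt_id' u).const_mul (2 : ℝ)).fun_neg.congr_deriv (by norm_num)
  have h2 := h1.const_rpow (a := (2 : ℝ)) (by norm_num)
  refine ((hasDerivAt_id u).mul h2).congr_deriv ?_
  simp only [id]
  ring

lemma deriv_mul_two_rpow : deriv (fun u : ℝ => u * (2 : ℝ) ^ (-(2 * u))) =
    fun u => (1 - 2 * Real.log 2 * u) * (2 : ℝ) ^ (-(2 * u)) :=
  funext fun u => (hasDerivAt_mul_two_rpow u).deriv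

/-- Since `log 2 < 1`, the critical point `1 / (2 log 2)` of `u 4^{-u}` lies beyond the freezing
point `1/2`. -/
lemma log_two_mul_le {u : ℝ} (h0 : 0 ≤ u) (h1 : u ≤ 1 / 2) : 2 * Real.log 2 * u ≤ 1 := by
  have := Real.log_two_lt_d9
  have := Real.log_pos one_lt_two
  nlinarith

lemma monotoneOn_mul_two_rpow :
    MonotoneOn (fun u : ℝ => u * (2 : ℝ) ^ (-(2 * u))) (Icc 0 (1 / 2)) := by
  apply monotoneOn_of_deriv_nonneg (convex_Icc _ _)
  · exact fun u _ => (hasDerivAt_mul_two_rpow u).continuousAt.continuousWithinAt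
  · exact fun u _ => (hasDerivAt_mul_two_rpow u).differentiableAt.differentiableWithinAt
  · intro u hu
    rw [interior_Icc] at hu
    rw [deriv_mul_two_rpow]
    have := log_two_mul_le hu.1.le hu.2.le
    have : (0 : ℝ) ≤ 1 - 2 * Real.log 2 * u := by linarith
    positivity

/-- The derivative is a product of two nonnegative decreasing factors. -/
lemma concaveOn_mul_two_rpow :
    ConcaveOn ℝ (Icc 0 (1 / 2)) (fun u : ℝ => u * (2 : ℝ) ^ (-(2 * u))) := by
  apply AntitoneOn.concaveOn_of_deriv (convex_Icc _ _)
  · exact fun u _ => (hasDerivAt_mul_two_rpow u).continuousAt.continuousWithinAt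
  · exact fun u _ => (hasDerivAt_mul_two_rpow u).differentiableAt.differentiableWithinAt
  · rw [interior_Icc, deriv_mul_two_rpow]
    intro u hu v hv huv
    have h1 := log_two_mul_le hv.1.le hv.2.le
    have := Real.log_pos one_lt_two
    refine mul_le_mul (by nlinarith) ?_ (by positivity) ?_
    · exact Real.rpow_le_rpow_of_exponent_le (by norm_num) (by linarith)
    · linarith [log_two_mul_le hu.1.le hu.2.le]

lemma bellmanProfile_nonneg {u : ℝ} (hu : 0 ≤ u) : 0 ≤ bellmanProfile u := by
  have : 0 ≤ min u (1 / 2) := le_min hu (by norm_num)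
  unfold bellmanProfile
  positivity

lemma monotoneOn_bellmanProfile : MonotoneOn bellmanProfile (Ici 0) := by
  intro u hu v hv huv
  exact monotoneOn_mul_two_rpow ⟨le_min hu (by norm_num), min_le_right _ _⟩
    ⟨le_min hv (by norm_num), min_le_right _ _⟩ (min_le_min_right _ huv)

/-- An increasing concave function composed with the concave function `min u (1/2)`. -/
lemma concaveOn_bellmanProfile : ConcaveOn ℝ (Ici 0) bellmanProfile := by
  refine ⟨convex_Ici _, fun u hu v hv a b ha hb hab => ?_⟩
  have mu : min u (1 / 2) ∈ Icc (0 : ℝ) (1 / 2) := ⟨le_min hu (by norm_num), min_le_right _ _⟩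
  have mv : min v (1 / 2) ∈ Icc (0 : ℝ) (1 / 2) := ⟨le_min hv (by norm_num), min_le_right _ _⟩
  have huv : 0 ≤ a • u + b • v :=
    add_nonneg (mul_nonneg ha hu) (mul_nonneg hb hv)
  refine (concaveOn_mul_two_rpow.2 mu mv ha hb hab).trans
    (monotoneOn_mul_two_rpow ((convex_Icc _ _) mu mv ha hb hab)
      ⟨le_min huv (by norm_num), min_le_right _ _⟩ (le_min ?_ ?_))
  · exact add_le_add (mul_le_mul_of_nonneg_left (min_le_left _ _) ha)
      (mul_le_mul_of_nonneg_left (min_le_left _ _) hb)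
  · exact ((convex_Icc _ _) mu mv ha hb hab).2

/-- The perspective `A h(x/A)` of a concave `h` is concave and `1`-homogeneous, hence superadditive.
Monotonicity of `h` serves the degenerate cases `A = 0` and `B = 0`, where the corresponding term
vanishes. -/
lemma perspective_superadditive {h : ℝ → ℝ} (hc : ConcaveOn ℝ (Ici 0) h)
    (hm : MonotoneOn h (Ici 0)) {x y A B : ℝ} (hx : 0 ≤ x) (hy : 0 ≤ y) (hA : 0 ≤ A)
    (hB : 0 ≤ B) : A * h (x / A) + B * h (y / B) ≤ (A + B) * h ((x + y) / (A + B)) := by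
  rcases hA.eq_or_lt with rfl | hA
  · simp only [zero_mul, zero_add]
    exact mul_le_mul_of_nonneg_left (hm (div_nonneg hy hB) (div_nonneg (by positivity) hB)
      (div_le_div_of_nonneg_right (by linarith) hB)) hB
  rcases hB.eq_or_lt with rfl | hB
  · simp only [zero_mul, add_zero]
    exact mul_le_mul_of_nonneg_left (hm (div_nonneg hx hA.le) (div_nonneg (by positivity) hA.le)
      (div_le_div_of_nonneg_right (by linarith) hA.le)) hA.le
  have this := hc.2 (mem_Ici.2 (div_nonneg hx hA.le)) (mem_Ici.2 (div_nonneg hy hB.le))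
    (div_nonneg hA.le (add_pos hA hB).le) (div_nonneg hB.le (add_pos hA hB).le)
    (by field_simp)
  simp only [smul_eq_mul] at this
  rw [show A / (A + B) * (x / A) + B / (A + B) * (y / B) = (x + y) / (A + B) by field_simp] at this
  have h2 := mul_le_mul_of_nonneg_left this (show 0 ≤ A + B by positivity)
  refine le_of_eq_of_le ?_ h2
  field_simp

/-- The majorant in the range `λ > 1`. -/
noncomputable def expMajorant (x A lam : ℝ) : ℝ := A * bellmanProfile (x / A) * 2 ^ (3 - lam)

/-- The majorant in the range `0 < λ ≤ 1`. -/
noncomputable def ratMajorant (x A lam : ℝ) : ℝ := min 1 (3 * x * A / (A * lam + 2 * x))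

/-- A majorant of the normalised size of the level set `{𝒜_S 1_E ≥ λ}` on an interval where `E` has
density `x` and the collection `S` has normalised mass `A`. -/
noncomputable def bellmanMajorant (x A lam : ℝ) : ℝ :=
  if lam ≤ 0 then 1 else if lam ≤ 1 then ratMajorant x A lam else expMajorant x A lam

lemma expMajorant_nonneg {x A lam : ℝ} (hx : 0 ≤ x) (hA : 0 ≤ A) : 0 ≤ expMajorant x A lam := by
  have := bellmanProfile_nonneg (div_nonneg hx hA)
  unfold expMajorant
  positivity

lemma bellmanMajorant_nonneg {x A lam : ℝ} (hx : 0 ≤ x) (hA : 0 ≤ A) :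
    0 ≤ bellmanMajorant x A lam := by
  unfold bellmanMajorant
  split_ifs with h0 h1
  · exact zero_le_one
  · push Not at h0
    exact le_min zero_le_one (by positivity)
  · exact expMajorant_nonneg hx hA

lemma bellmanMajorant_of_nonpos {x A lam : ℝ} (h : lam ≤ 0) : bellmanMajorant x A lam = 1 :=
  if_pos h

/-! ### Concavity of the majorant in density and mass -/

lemma expMajorant_superadditive {x y A B lam : ℝ} (hx : 0 ≤ x) (hy : 0 ≤ y) (hA : 0 ≤ A)
    (hB : 0 ≤ B) :
    expMajorant x A lam + expMajorant y B lam ≤ expMajorant (x + y) (A + B) lam := by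
  unfold expMajorant
  rw [← add_mul]
  exact mul_le_mul_of_nonneg_right (perspective_superadditive concaveOn_bellmanProfile
    monotoneOn_bellmanProfile hx hy hA hB) (by positivity)

lemma expMajorant_half (x A lam : ℝ) :
    expMajorant (x / 2) (A / 2) lam = expMajorant x A lam / 2 := by
  unfold expMajorant
  rw [div_div_div_cancel_right₀ two_ne_zero]
  ring

/-- For positive `x`, `A` each term is `1 / (λ/(3x) + 2/(3A))`, a weighted harmonic mean up to
scaling, so it is concave and `1`-homogeneous. -/
lemma rational_superadditive {x y A B lam : ℝ} (hlam : 0 < lam) (hx : 0 ≤ x) (hy : 0 ≤ y)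
    (hA : 0 ≤ A) (hB : 0 ≤ B) :
    3 * x * A / (A * lam + 2 * x) + 3 * y * B / (B * lam + 2 * y) ≤
      3 * (x + y) * (A + B) / ((A + B) * lam + 2 * (x + y)) := by
  have mono : ∀ {x y A B : ℝ}, 0 ≤ x → 0 ≤ y → 0 ≤ A → 0 ≤ B → A * lam + 2 * x = 0 →
      3 * x * A / (A * lam + 2 * x) + 3 * y * B / (B * lam + 2 * y) ≤
      3 * (x + y) * (A + B) / ((A + B) * lam + 2 * (x + y)) := by
    intro x y A B hx hy hA hB h
    have h1 : A * lam = 0 := by nlinarith [mul_nonneg hA hlam.le]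
    have hx0 : x = 0 := by linarith
    have hA0 : A = 0 := by simpa [hlam.ne'] using h1
    simp [hx0, hA0]
  rcases (show 0 ≤ A * lam + 2 * x by positivity).eq_or_lt with h | h1
  · exact mono hx hy hA hB h.symm
  rcases (show 0 ≤ B * lam + 2 * y by positivity).eq_or_lt with h | h2
  · have := mono hy hx hB hA h.symm
    rwa [add_comm, add_comm x, add_comm A]
  rw [div_add_div _ _ h1.ne' h2.ne', div_le_div_iff₀ (by positivity) (by linarith)]
  have key : 3 * (x + y) * (A + B) * ((A * lam + 2 * x) * (B * lam + 2 * y)) -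
      (3 * x * A * (B * lam + 2 * y) + (A * lam + 2 * x) * (3 * y * B)) *
        ((A + B) * lam + 2 * (x + y)) = 6 * lam * (x * B - y * A) ^ 2 := by ring
  nlinarith [mul_nonneg hlam.le (sq_nonneg (x * B - y * A))]

lemma bellmanMajorant_midpoint {x y A B lam : ℝ} (hx : 0 ≤ x) (hy : 0 ≤ y) (hA : 0 ≤ A)
    (hB : 0 ≤ B) : (bellmanMajorant x A lam + bellmanMajorant y B lam) / 2 ≤
      bellmanMajorant ((x + y) / 2) ((A + B) / 2) lam := by
  unfold bellmanMajorant
  split_ifs with h0 h1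
  · norm_num
  · push Not at h0
    have h := rational_superadditive h0 (x := x / 2) (y := y / 2) (A := A / 2) (B := B / 2)
      (by positivity) (by positivity) (by positivity) (by positivity)
    have e : ∀ x A : ℝ, 3 * (x / 2) * (A / 2) / (A / 2 * lam + 2 * (x / 2)) =
        3 * x * A / (A * lam + 2 * x) / 2 := by
      intro x A
      rw [show 3 * (x / 2) * (A / 2) = 3 * x * A / 2 / 2 by ring,
        show A / 2 * lam + 2 * (x / 2) = (A * lam + 2 * x) / 2 by ring,
        div_div_div_cancel_right₀ two_ne_zero]
      ring
    rw [e, e, ← add_div, ← add_div, ← add_div] at h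
    unfold ratMajorant
    refine le_min ?_ (le_trans ?_ h)
    · linarith [min_le_left 1 (3 * x * A / (A * lam + 2 * x)),
        min_le_left 1 (3 * y * B / (B * lam + 2 * y))]
    · linarith [min_le_right 1 (3 * x * A / (A * lam + 2 * x)),
        min_le_right 1 (3 * y * B / (B * lam + 2 * y))]
  · have h := expMajorant_superadditive (x := x / 2) (y := y / 2) (A := A / 2) (B := B / 2)
      (lam := lam) (by positivity) (by positivity) (by positivity) (by positivity)
    rw [expMajorant_half, expMajorant_half] at h
    rw [add_div, add_div, add_div]
    exact h

/-! ### The jump inequality -/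

lemma expMajorant_of_le {x A lam : ℝ} (hA : 0 < A) (h : 2 * x ≤ A) :
    expMajorant x A lam = x * 2 ^ (3 - 2 * x / A - lam) := by
  have : x / A ≤ 1 / 2 := by rw [div_le_iff₀ hA]; linarith
  unfold expMajorant bellmanProfile
  rw [min_eq_left this, show 3 - 2 * x / A - lam = -(2 * (x / A)) + (3 - lam) by ring,
    Real.rpow_add two_pos]
  field_simp

lemma expMajorant_of_ge {x A lam : ℝ} (hA : 0 ≤ A) (h : A ≤ 2 * x) :
    expMajorant x A lam = A * 2 ^ (1 - lam) := by
  rcases hA.eq_or_lt with rfl | hA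
  · simp [expMajorant]
  have : 1 / 2 ≤ x / A := by rw [le_div_iff₀ hA]; linarith
  unfold expMajorant bellmanProfile
  rw [min_eq_right this, show 3 - lam = 2 + (1 - lam) by ring, Real.rpow_add two_pos]
  norm_num
  ring

/-- Multiplied by `2x` this compares the exponents before and after a jump: `x + 2x/(B+1) ≤ 2x/B`.
Equality holds at `B = 1`, the case that saturates mass `2`. -/
lemma half_add_inv_le {B : ℝ} (h0 : 0 < B) (h1 : B ≤ 1) : 1 / 2 + 1 / (B + 1) ≤ 1 / B := by
  rw [div_add_div _ _ two_ne_zero (by positivity), div_le_div_iff₀ (by positivity) h0]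
  nlinarith

lemma expMajorant_jump {x B lam : ℝ} (hx0 : 0 ≤ x) (hx1 : x ≤ 1) (hB0 : 0 ≤ B) (hB1 : B ≤ 1) :
    expMajorant x B (lam - x) ≤ expMajorant x (B + 1) lam := by
  rcases hB0.eq_or_lt with rfl | hB
  · refine le_trans (le_of_eq ?_) (expMajorant_nonneg hx0 (by norm_num))
    simp [expMajorant]
  have hinv := half_add_inv_le hB hB1
  rcases le_total (2 * x) B with h | h
  · rw [expMajorant_of_le hB h, expMajorant_of_le (by linarith) (by linarith)]
    refine mul_le_mul_of_nonneg_left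
      (Real.rpow_le_rpow_of_exponent_le (by norm_num) ?_) hx0
    have := mul_le_mul_of_nonneg_left hinv (show 0 ≤ 2 * x by positivity)
    rw [mul_add, mul_one_div, mul_one_div, mul_one_div] at this
    linarith
  rw [expMajorant_of_ge hB0 h]
  rcases le_total (2 * x) (B + 1) with h' | h'
  · rw [expMajorant_of_le (by linarith) h']
    -- In the mixed regime `B ≤ 2x ≤ B + 1` the two sides differ by the factor `2^(c·2x)`. It is
    -- bounded by the chord of `2^s` over `[cB, c(B+1)]`, whose end values are at most `2` and `4`;
    -- what remains is a polynomial inequality.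
    set c : ℝ := 1 / 2 + 1 / (B + 1) with hc
    have hcB : c * B ≤ 1 := by
      calc c * B ≤ 1 / B * B := mul_le_mul_of_nonneg_right hinv hB0
        _ = 1 := by field_simp
    have hcA : c * (B + 1) = (B + 1) / 2 + 1 := by rw [hc]; field_simp
    have hcpos : 0 < c := by positivity
    have hch := two_rpow_chord (a := c * B) (b := c * (B + 1)) (s := c * (2 * x))
      (by nlinarith) (by gcongr) (by gcongr)
    have e1 : (2 : ℝ) ^ (c * B) ≤ 2 := by
      simpa using Real.rpow_le_rpow_of_exponent_le (x := 2) (by norm_num) hcB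
    have e2 : (2 : ℝ) ^ (c * (B + 1)) ≤ 4 := by
      have := Real.rpow_le_rpow_of_exponent_le (x := 2) (y := c * (B + 1)) (z := 2) (by norm_num)
        (by linarith)
      refine this.trans_eq ?_
      norm_num
    have e3 : (2 : ℝ) ^ (c * (2 * x)) ≤ (B + 1 - 2 * x) * 2 + (2 * x - B) * 4 := by
      have : c * (2 : ℝ) ^ (c * (2 * x)) ≤ c * ((B + 1 - 2 * x) * 2 + (2 * x - B) * 4) := by
        calc c * (2 : ℝ) ^ (c * (2 * x))
            = 2 ^ (c * (2 * x)) * (c * (B + 1) - c * B) := by ring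
          _ ≤ _ := hch
          _ = c * ((B + 1 - 2 * x) * 2 ^ (c * B) + (2 * x - B) * 2 ^ (c * (B + 1))) := by ring
          _ ≤ _ := by
            have : 0 ≤ B + 1 - 2 * x := by linarith
            have : 0 ≤ 2 * x - B := by linarith
            gcongr
      exact le_of_mul_le_mul_left this hcpos
    have e4 : B * 2 ^ (c * (2 * x)) ≤ 4 * x := by
      calc B * 2 ^ (c * (2 * x)) ≤ B * ((B + 1 - 2 * x) * 2 + (2 * x - B) * 4) := by gcongr
        _ ≤ 4 * x := by nlinarith [mul_nonneg (sub_nonneg.2 h) (sub_nonneg.2 hB1)]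
    have e5 : (2 : ℝ) ^ (1 - (lam - x)) =
        2 ^ (c * (2 * x)) * (2 ^ (3 - 2 * x / (B + 1) - lam) / 4) := by
      rw [show (4 : ℝ) = 2 ^ (2 : ℝ) by norm_num, ← Real.rpow_sub two_pos,
        ← Real.rpow_add two_pos]
      congr 1
      rw [hc]
      ring
    rw [e5, ← mul_assoc]
    calc _ ≤ 4 * x * ((2 : ℝ) ^ (3 - 2 * x / (B + 1) - lam) / 4) := by gcongr
      _ = _ := by ring
  · rw [expMajorant_of_ge (by linarith) h', show 1 - (lam - x) = x + (1 - lam) by ring,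
      Real.rpow_add two_pos, ← mul_assoc]
    have : (2 : ℝ) ^ x ≤ 2 := by
      simpa using Real.rpow_le_rpow_of_exponent_le (x := 2) (by norm_num) hx1
    have : B * 2 ^ x ≤ B + 1 := by nlinarith
    gcongr

/-- This is the jump across level `1`. Here `λ ≤ 1 + x ≤ 2`, so convexity of `2^s` on short ranges
reduces everything to polynomial inequalities. -/
lemma ratMajorant_le_expMajorant {x B lam : ℝ} (hx0 : 0 ≤ x) (hx1 : x ≤ 1) (hB0 : 0 ≤ B)
    (hB1 : B ≤ 1) (hlam : 1 < lam) (hlamx : lam - x ≤ 1) :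
    ratMajorant x B (lam - x) ≤ expMajorant x (B + 1) lam := by
  refine (min_le_right _ _).trans ?_
  have hnn : 0 ≤ expMajorant x (B + 1) lam := expMajorant_nonneg hx0 (by linarith)
  rcases hB0.eq_or_lt with rfl | hB
  · simpa using hnn
  rcases hx0.eq_or_lt with rfl | hx
  · simpa using hnn
  have hD : 0 < B * (lam - x) + 2 * x := by nlinarith
  rcases le_total (2 * x) (B + 1) with h | h
  · rw [expMajorant_of_le (by linarith) h]
    set p := 2 * x / (B + 1) with hp
    have hp0 : 0 ≤ p := by positivity
    have hp1 : p ≤ 1 := by rw [hp, div_le_one (by linarith)]; exact h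
    have hBp : B * (x + p) ≤ 2 * x := by
      have := mul_le_mul_of_nonneg_left (half_add_inv_le hB hB1) (show 0 ≤ B * (2 * x) by positivity)
      calc B * (x + p) = B * (2 * x) * (1 / 2 + 1 / (B + 1)) := by rw [hp]; ring
        _ ≤ _ := this
        _ = 2 * x := by field_simp
    -- On `[1, 3]` the function `s 2^(3-s)` has minimum `3`, attained at `s = 3`; this matches the
    -- constant `3` in the rational majorant.
    have hs : 3 * (2 : ℝ) ^ (lam + p) ≤ 8 * (lam + p) := by
      have := two_rpow_chord (a := 1) (b := 3) (s := lam + p) (by norm_num) (by linarith)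
        (by linarith)
      norm_num at this
      linarith
    have hs' : 3 ≤ (lam + p) * 2 ^ (3 - p - lam) := by
      rw [show 3 - p - lam = 3 - (lam + p) by ring, Real.rpow_sub two_pos, ← mul_div_assoc,
        le_div_iff₀ (by positivity)]
      norm_num
      linarith
    rw [div_le_iff₀ hD]
    calc 3 * x * B ≤ (lam + p) * 2 ^ (3 - p - lam) * x * B := by gcongr
      _ = x * 2 ^ (3 - p - lam) * (B * (lam - x) + B * (x + p)) := by ring
      _ ≤ _ := by gcongr
  · rw [expMajorant_of_ge (by linarith) h, div_le_iff₀ hD]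
    have hmu : (2 : ℝ) ^ (lam - 1) ≤ lam := by
      have := two_rpow_chord (a := 0) (b := 1) (s := lam - 1) (by norm_num) (by linarith)
        (by linarith)
      norm_num at this
      linarith
    have hmu' : 1 ≤ lam * 2 ^ (1 - lam) := by
      rw [show 1 - lam = -(lam - 1) by ring, Real.rpow_neg two_pos.le, ← div_eq_mul_inv,
        le_div_iff₀ (by positivity)]
      linarith
    have hmain : 3 * x * B * lam ≤ (B + 1) * (B * (lam - x) + 2 * x) := by
      nlinarith [mul_nonneg (mul_nonneg hx0 hB0) (sub_nonneg.2 hlamx),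
        mul_nonneg hB0 (sub_nonneg.2 hlamx), mul_nonneg (mul_nonneg hx0 hB0) (sub_nonneg.2 hx1),
        mul_nonneg hx0 (mul_nonneg (sub_nonneg.2 hB1) (sub_nonneg.2 hB1)),
        mul_nonneg (mul_nonneg (sub_nonneg.2 hB1) hB0) (sub_nonneg.2 hlamx),
        mul_nonneg (sub_nonneg.2 hB1) hx0, mul_nonneg (sub_nonneg.2 hB1) hB0,
        mul_nonneg (mul_nonneg (sub_nonneg.2 hB1) hB0) (sub_nonneg.2 hx1)]
    calc 3 * x * B ≤ 3 * x * B * (lam * 2 ^ (1 - lam)) := le_mul_of_one_le_right (by positivity) hmu'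
      _ = 3 * x * B * lam * 2 ^ (1 - lam) := by ring
      _ ≤ (B + 1) * (B * (lam - x) + 2 * x) * 2 ^ (1 - lam) := by gcongr
      _ = _ := by ring

lemma ratMajorant_jump {x B lam : ℝ} (hx0 : 0 ≤ x) (hB0 : 0 ≤ B) (hB1 : B ≤ 1)
    (hlam : x < lam) : ratMajorant x B (lam - x) ≤ ratMajorant x (B + 1) lam := by
  refine min_le_min_left _ ?_
  rcases hx0.eq_or_lt with rfl | hx
  · simp
  have h1 : 0 < B * (lam - x) + 2 * x := by nlinarith
  have h2 : 0 < (B + 1) * lam + 2 * x := by nlinarith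
  -- After cancellation the claim is `B (B + 1) ≤ 2`.
  rw [div_le_div_iff₀ h1 h2]
  nlinarith [mul_nonneg (mul_nonneg hx0 hx0) (sub_nonneg.2 hB1),
    mul_nonneg (mul_nonneg hx0 hx0) (mul_nonneg hB0 (sub_nonneg.2 hB1))]

lemma ratMajorant_eq_one {x B lam : ℝ} (hB0 : 0 ≤ B) (hlam0 : 0 < lam) (hlam : lam ≤ x) :
    ratMajorant x (B + 1) lam = 1 := by
  refine min_eq_left ?_
  rw [le_div_iff₀ (by nlinarith)]
  -- At `λ = x` the rational expression is `3A / (A + 2)` with `A = B + 1`, which is at least `1`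
  -- exactly when `A ≥ 1`.
  nlinarith [mul_nonneg hB0 (sub_nonneg.2 hlam)]

lemma bellmanMajorant_jump {x B lam : ℝ} (hx0 : 0 ≤ x) (hx1 : x ≤ 1) (hB0 : 0 ≤ B)
    (hB1 : B ≤ 1) : bellmanMajorant x B (lam - x) ≤ bellmanMajorant x (B + 1) lam := by
  unfold bellmanMajorant
  split_ifs with h1 h2 h3 h4 h5 h6 h7 h8
  · exact le_rfl
  · exact (ratMajorant_eq_one hB0 (by linarith) (by linarith)).ge
  · linarith
  · linarith
  · exact ratMajorant_jump hx0 hB0 hB1 (by linarith)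
  · exact ratMajorant_le_expMajorant hx0 hx1 hB0 hB1 (by linarith) h4
  · linarith
  · linarith
  · exact expMajorant_jump hx0 hx1 hB0 hB1

lemma bellmanMajorant_le {x A lam : ℝ} (hx0 : 0 ≤ x) (hx1 : x ≤ 1) (hA0 : 0 ≤ A) (hA2 : A ≤ 2)
    (hlam : 1 < lam) : bellmanMajorant x A lam ≤ x * 2 ^ (3 - x - lam) := by
  -- Adding the pair `(0, 2 - A)` raises the mass to `2` without changing the density.
  have h := expMajorant_superadditive (lam := lam) hx0 le_rfl hA0 (sub_nonneg.2 hA2)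
  have h0 : 0 ≤ expMajorant 0 (2 - A) lam := expMajorant_nonneg le_rfl (sub_nonneg.2 hA2)
  rw [add_zero, add_sub_cancel, expMajorant_of_le two_pos (by linarith),
    mul_div_cancel_left₀ _ two_ne_zero] at h
  rw [bellmanMajorant, if_neg (by linarith), if_neg (by linarith)]
  linarith

/-! ### Dyadic intervals -/

/-- The dyadic interval `[k 2^{-j}, (k+1) 2^{-j})` with `j ≥ 0`. -/
def dyadicIco (j : ℕ) (k : ℤ) : Set ℝ := Ico ((k : ℝ) / 2 ^ j) (((k : ℝ) + 1) / 2 ^ j)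

lemma mem_dyadicIco {j : ℕ} {k : ℤ} {t : ℝ} : t ∈ dyadicIco j k ↔ ⌊t * 2 ^ j⌋ = k := by
  have h : (0 : ℝ) < 2 ^ j := by positivity
  rw [Int.floor_eq_iff, dyadicIco, mem_Ico, div_le_iff₀ h, lt_div_iff₀ h]

lemma div_two_pow_le (j : ℕ) (k : ℤ) : (k : ℝ) / 2 ^ j ≤ ((k : ℝ) + 1) / 2 ^ j := by
  gcongr
  linarith

lemma div_two_pow_lt (j : ℕ) (k : ℤ) : (k : ℝ) / 2 ^ j < ((k : ℝ) + 1) / 2 ^ j := by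
  gcongr
  linarith

lemma measurableSet_dyadicIco (j : ℕ) (k : ℤ) : MeasurableSet (dyadicIco j k) := measurableSet_Ico

lemma volume_dyadicIco (j : ℕ) (k : ℤ) : volume (dyadicIco j k) = ENNReal.ofReal (1 / 2 ^ j) := by
  rw [dyadicIco, Real.volume_Ico, ← sub_div, add_sub_cancel_left]

lemma volume_dyadicIco_ne_top (j : ℕ) (k : ℤ) : volume (dyadicIco j k) ≠ ⊤ := by
  rw [volume_dyadicIco]
  exact ENNReal.ofReal_ne_top

lemma volume_real_dyadicIco (j : ℕ) (k : ℤ) : volume.real (dyadicIco j k) = 1 / 2 ^ j := by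
  rw [Measure.real, volume_dyadicIco, ENNReal.toReal_ofReal (by positivity)]

lemma dyadicIco_union (j : ℕ) (k : ℤ) :
    dyadicIco (j + 1) (2 * k) ∪ dyadicIco (j + 1) (2 * k + 1) = dyadicIco j k := by
  have e1 : ((2 * k : ℤ) : ℝ) / 2 ^ (j + 1) = k / 2 ^ j := by
    push_cast
    rw [pow_succ]
    field_simp
  have e2 : (((2 * k + 1 : ℤ) : ℝ) + 1) / 2 ^ (j + 1) = (k + 1) / 2 ^ j := by
    push_cast
    rw [pow_succ]
    field_simp
    ring
  have e3 : ((2 * k + 1 : ℤ) : ℝ) / 2 ^ (j + 1) = ((2 * k : ℤ) + 1) / 2 ^ (j + 1) := by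
    push_cast
    rfl
  have h1 := div_two_pow_le (j + 1) (2 * k)
  have h2 := div_two_pow_le (j + 1) (2 * k + 1)
  unfold dyadicIco
  rw [e1] at h1 ⊢
  rw [e2, e3] at *
  exact Ico_union_Ico_eq_Ico h1 h2

lemma disjoint_dyadicIco {j : ℕ} {k l : ℤ} (h : k ≠ l) :
    Disjoint (dyadicIco j k) (dyadicIco j l) :=
  Set.disjoint_left.2 fun _ hk hl => h ((mem_dyadicIco.1 hk).symm.trans (mem_dyadicIco.1 hl))

lemma dyadicIco_inj {i j : ℕ} {k l : ℤ} (h : dyadicIco i k = dyadicIco j l) : i = j ∧ k = l := by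
  have hij : i = j := by
    have := congrArg volume.real h
    rw [volume_real_dyadicIco, volume_real_dyadicIco, one_div, one_div, inv_inj] at this
    exact pow_right_injective₀ (M₀ := ℝ) (by norm_num) (by norm_num) this
  subst hij
  refine ⟨rfl, ?_⟩
  have hm : (k : ℝ) / 2 ^ i ∈ dyadicIco i k := left_mem_Ico.2 (div_two_pow_lt i k)
  exact (mem_dyadicIco.1 hm).symm.trans (mem_dyadicIco.1 (h ▸ hm))

lemma not_dyadicIco_subset_succ (j : ℕ) (k l : ℤ) : ¬ dyadicIco j k ⊆ dyadicIco (j + 1) l := by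
  intro h
  have := measureReal_mono h (volume_dyadicIco_ne_top _ _)
  rw [volume_real_dyadicIco, volume_real_dyadicIco, one_div_le_one_div (by positivity)
    (by positivity)] at this
  exact absurd (pow_lt_pow_right₀ (one_lt_two (α := ℝ)) (Nat.lt_succ_self j)) (not_lt.2 this)

lemma dyadicIco_zero_zero : dyadicIco 0 0 = Ico 0 1 := by
  simp [dyadicIco]

lemma isDyadicInterval_dyadicIco (j : ℕ) (k : ℤ) : IsDyadicInterval (dyadicIco j k) := by
  refine ⟨j, k, ?_⟩
  rw [dyadicIco, zpow_neg, zpow_natCast, div_eq_mul_inv, div_eq_mul_inv]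

lemma exists_eq_dyadicIco {J : Set ℝ} (hJ : J ∈ dyadicSubintervals (Ico (0 : ℝ) 1)) :
    ∃ (j : ℕ) (k : ℤ), J = dyadicIco j k := by
  obtain ⟨⟨j, k, rfl⟩, hsub⟩ := hJ
  have hj : 0 ≤ j := by
    have h := measureReal_mono (μ := volume) hsub (by simp)
    rw [Real.volume_real_Ico_of_le (by gcongr; linarith),
      Real.volume_real_Ico_of_le zero_le_one, ← sub_mul, add_sub_cancel_left, one_mul, sub_zero] at h
    by_contra! hj
    exact absurd (one_lt_zpow₀ (one_lt_two (α := ℝ)) (neg_pos.2 hj)) (not_lt.2 h)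
  lift j to ℕ using hj
  refine ⟨j, k, ?_⟩
  rw [dyadicIco, zpow_neg, zpow_natCast, div_eq_mul_inv, div_eq_mul_inv]

/-! ### Densities, Carleson masses and truncated sums -/

/-- The density `|E ∩ I| / |I|` of `E` in the dyadic interval `I = dyadicIco j k`. -/
noncomputable def density (E : Set ℝ) (j : ℕ) (k : ℤ) : ℝ := volume.real (E ∩ dyadicIco j k) * 2 ^ j

lemma density_nonneg (E : Set ℝ) (j : ℕ) (k : ℤ) : 0 ≤ density E j k := by
  unfold density
  positivity

lemma density_le_one (E : Set ℝ) (j : ℕ) (k : ℤ) : density E j k ≤ 1 := by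
  have := measureReal_mono (μ := volume) (inter_subset_right (s := E) (t := dyadicIco j k))
    (volume_dyadicIco_ne_top _ _)
  rw [volume_real_dyadicIco, le_div_iff₀ (by positivity)] at this
  exact this

lemma density_eq_average (E : Set ℝ) (j : ℕ) (k : ℤ) : density E j k =
    (density E (j + 1) (2 * k) + density E (j + 1) (2 * k + 1)) / 2 := by
  have h : volume.real (E ∩ dyadicIco j k) = volume.real (E ∩ dyadicIco (j + 1) (2 * k)) +
      volume.real (E ∩ dyadicIco (j + 1) (2 * k + 1)) := by
    rw [← dyadicIco_union, inter_union_distrib_left]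
    have hfin : ∀ l, volume (E ∩ dyadicIco (j + 1) l) ≠ ⊤ := fun l =>
      measure_ne_top_of_subset inter_subset_right (volume_dyadicIco_ne_top (j + 1) l)
    have hd : Disjoint (dyadicIco (j + 1) (2 * k)) (dyadicIco (j + 1) (2 * k + 1)) :=
      disjoint_dyadicIco (by omega)
    rw [measureReal_def, measureReal_def, measureReal_def, ← ENNReal.toReal_add (hfin _) (hfin _)]
    congr 1
    refine le_antisymm (measure_union_le _ _) ?_
    -- Only the half interval has to be measurable: it splits the outer measure of the part of `E`
    -- in `I`.
    rw [← measure_inter_add_sdiff (μ := volume) (E ∩ _ ∪ E ∩ _)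
      (measurableSet_dyadicIco (j + 1) (2 * k))]
    refine add_le_add (measure_mono (μ := volume) ?_) (measure_mono (μ := volume) ?_)
    · exact fun t ht => ⟨Or.inl ht, ht.2⟩
    · exact fun t ht => ⟨Or.inr ht, fun h => Set.disjoint_left.1 hd h ht.2⟩
  rw [density, density, density, h, pow_succ]
  ring

open Classical in
/-- The mass `∑ |J| / |I|` over the members `J ⊆ I` of `S` in the first `d` generations below
`I = dyadicIco j k`. -/
noncomputable def carlesonMass (S : Set (Set ℝ)) : ℕ → ℕ → ℤ → ℝ
  | 0, _, _ => 0
  | d + 1, j, k => (if dyadicIco j k ∈ S then 1 else 0) +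
      (carlesonMass S d (j + 1) (2 * k) + carlesonMass S d (j + 1) (2 * k + 1)) / 2

lemma carlesonMass_nonneg (S : Set (Set ℝ)) (d j : ℕ) (k : ℤ) : 0 ≤ carlesonMass S d j k := by
  induction d generalizing j k with
  | zero => exact le_rfl
  | succ d ih =>
    have := ih (j + 1) (2 * k)
    have := ih (j + 1) (2 * k + 1)
    rw [carlesonMass]
    split_ifs <;> positivity

/-- `U` is the union of the sets `F J` over the counted `J`. Recording that each of its points lies
in some `F J` with `J` inside the current interval makes `U` disjoint from the `F` of any larger
interval, so the measures add up. -/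
lemma exists_carlesonMass_le {S : Set (Set ℝ)} {F : Set ℝ → Set ℝ}
    (hF : ∀ J ∈ S, F J ⊆ J ∧ MeasurableSet (F J) ∧ volume J / 2 ≤ volume (F J))
    (hdisj : S.PairwiseDisjoint F) (d j : ℕ) (k : ℤ) :
    ∃ U : Set ℝ, MeasurableSet U ∧ U ⊆ dyadicIco j k ∧
      (∀ t ∈ U, ∃ J ∈ S, J ⊆ dyadicIco j k ∧ t ∈ F J) ∧
      carlesonMass S d j k / 2 ^ j ≤ 2 * volume.real U := by
  induction d generalizing j k with
  | zero => exact ⟨∅, MeasurableSet.empty, empty_subset _, by simp, by simp [carlesonMass]⟩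
  | succ d ih =>
    obtain ⟨U, hUm, hUs, hUF, hU⟩ := ih (j + 1) (2 * k)
    obtain ⟨V, hVm, hVs, hVF, hV⟩ := ih (j + 1) (2 * k + 1)
    have hsub1 : dyadicIco (j + 1) (2 * k) ⊆ dyadicIco j k :=
      dyadicIco_union j k ▸ subset_union_left
    have hsub2 : dyadicIco (j + 1) (2 * k + 1) ⊆ dyadicIco j k :=
      dyadicIco_union j k ▸ subset_union_right
    have hUV : volume.real (U ∪ V) = volume.real U + volume.real V :=
      measureReal_union ((disjoint_dyadicIco (by omega)).mono hUs hVs) hVm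
        (measure_ne_top_of_subset hUs (volume_dyadicIco_ne_top _ _))
        (measure_ne_top_of_subset hVs (volume_dyadicIco_ne_top _ _))
    have hUVF : ∀ t ∈ U ∪ V, ∃ J ∈ S, J ⊆ dyadicIco j k ∧ J ≠ dyadicIco j k ∧ t ∈ F J := by
      rintro t (ht | ht)
      · obtain ⟨J, hJ, hJs, htJ⟩ := hUF t ht
        exact ⟨J, hJ, hJs.trans hsub1, fun h => not_dyadicIco_subset_succ _ _ _ (h ▸ hJs), htJ⟩
      · obtain ⟨J, hJ, hJs, htJ⟩ := hVF t ht
        exact ⟨J, hJ, hJs.trans hsub2, fun h => not_dyadicIco_subset_succ _ _ _ (h ▸ hJs), htJ⟩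
    have hUVs : U ∪ V ⊆ dyadicIco j k := union_subset (hUs.trans hsub1) (hVs.trans hsub2)
    have hhalf : (carlesonMass S d (j + 1) (2 * k) + carlesonMass S d (j + 1) (2 * k + 1)) / 2 /
        2 ^ j ≤ 2 * volume.real (U ∪ V) := by
      rw [hUV, mul_add]
      refine le_trans (le_of_eq ?_) (add_le_add hU hV)
      rw [pow_succ]
      field_simp
    rw [carlesonMass]
    split_ifs with hI
    · obtain ⟨hFs, hFm, hFv⟩ := hF _ hI
      have hd : Disjoint (F (dyadicIco j k)) (U ∪ V) := by
        refine Set.disjoint_left.2 fun t ht htU => ?_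
        obtain ⟨J, hJ, -, hne, htJ⟩ := hUVF t htU
        exact Set.disjoint_left.1 (hdisj hJ hI hne) htJ ht
      refine ⟨F (dyadicIco j k) ∪ (U ∪ V), hFm.union (hUm.union hVm), union_subset hFs hUVs, ?_, ?_⟩
      · rintro t (ht | ht)
        · exact ⟨_, hI, Subset.rfl, ht⟩
        · obtain ⟨J, hJ, hJs, -, htJ⟩ := hUVF t ht
          exact ⟨J, hJ, hJs, htJ⟩
      · rw [measureReal_union hd (hUm.union hVm)
          (measure_ne_top_of_subset hFs (volume_dyadicIco_ne_top _ _))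
          (measure_ne_top_of_subset hUVs (volume_dyadicIco_ne_top _ _)), add_div, mul_add]
        refine add_le_add ?_ hhalf
        have := ENNReal.toReal_mono
          (measure_ne_top_of_subset hFs (volume_dyadicIco_ne_top _ _)) hFv
        rw [ENNReal.toReal_div, ← Measure.real, ← Measure.real, volume_real_dyadicIco] at this
        norm_num at this ⊢
        linarith
    · refine ⟨U ∪ V, hUm.union hVm, hUVs, ?_, by rwa [zero_add]⟩
      intro t ht
      obtain ⟨J, hJ, hJs, -, htJ⟩ := hUVF t ht
      exact ⟨J, hJ, hJs, htJ⟩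

lemma carlesonMass_le_two {S : Set (Set ℝ)} (hS : IsSparse S) (d j : ℕ) (k : ℤ) :
    carlesonMass S d j k ≤ 2 := by
  obtain ⟨-, F, hF, hdisj⟩ := hS
  obtain ⟨U, -, hUs, -, hU⟩ := exists_carlesonMass_le hF hdisj d j k
  have h := measureReal_mono hUs (volume_dyadicIco_ne_top _ _)
  rw [volume_real_dyadicIco] at h
  have := hU.trans (mul_le_mul_of_nonneg_left h zero_le_two)
  rw [mul_one_div] at this
  exact (div_le_div_iff_of_pos_right (by positivity)).1 this

open Classical in
/-- The contribution of generation `j` to `𝒜_S 1_E (t)`. -/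
noncomputable def sparseLayer (S : Set (Set ℝ)) (E : Set ℝ) (j : ℕ) (t : ℝ) : ℝ :=
  if dyadicIco j ⌊t * 2 ^ j⌋ ∈ S then density E j ⌊t * 2 ^ j⌋ else 0

lemma sparseLayer_nonneg (S : Set (Set ℝ)) (E : Set ℝ) (j : ℕ) (t : ℝ) :
    0 ≤ sparseLayer S E j t := by
  unfold sparseLayer
  split_ifs
  exacts [density_nonneg _ _ _, le_rfl]

/-- The contribution of the generations `j, …, j + d - 1` to `𝒜_S 1_E (t)`. -/
noncomputable def truncatedSum (S : Set (Set ℝ)) (E : Set ℝ) (d j : ℕ) (t : ℝ) : ℝ :=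
  ∑ i ∈ Finset.range d, sparseLayer S E (j + i) t

lemma truncatedSum_succ (S : Set (Set ℝ)) (E : Set ℝ) (d j : ℕ) (t : ℝ) :
    truncatedSum S E (d + 1) j t = sparseLayer S E j t + truncatedSum S E d (j + 1) t := by
  rw [truncatedSum, Finset.sum_range_succ', add_comm, add_zero, truncatedSum]
  simp only [add_assoc, add_comm 1]

/-- Peel off the top generation, which is constant on `I`, apply the induction hypothesis on both
halves at the lowered level, and recombine by midpoint concavity; if `I ∈ S`, the jump inequality
restores the level. -/
theorem volume_truncatedSum_le {S : Set (Set ℝ)} (hS : IsSparse S) (E : Set ℝ) (d j : ℕ) (k : ℤ)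
    (lam : ℝ) : volume.real {t ∈ dyadicIco j k | lam ≤ truncatedSum S E d j t} ≤
      bellmanMajorant (density E j k) (carlesonMass S d j k) lam / 2 ^ j := by
  induction d generalizing j k lam with
  | zero =>
    rcases le_or_gt lam 0 with h | h
    · rw [bellmanMajorant_of_nonpos h, ← volume_real_dyadicIco j k]
      exact measureReal_mono (sep_subset _ _) (volume_dyadicIco_ne_top _ _)
    · have : {t ∈ dyadicIco j k | lam ≤ truncatedSum S E 0 j t} = ∅ := by
        ext t
        simp [truncatedSum, h]
      rw [this, measureReal_empty]
      exact div_nonneg (bellmanMajorant_nonneg (density_nonneg _ _ _)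
        (carlesonMass_nonneg _ _ _ _)) (by positivity)
  | succ d ih =>
    set A := (carlesonMass S d (j + 1) (2 * k) + carlesonMass S d (j + 1) (2 * k + 1)) / 2 with hA
    have hA0 : 0 ≤ A := by
      have := carlesonMass_nonneg S d (j + 1) (2 * k)
      have := carlesonMass_nonneg S d (j + 1) (2 * k + 1)
      positivity
    have split : ∀ c : ℝ, (∀ t ∈ dyadicIco j k, sparseLayer S E j t = c) →
        volume.real {t ∈ dyadicIco j k | lam ≤ truncatedSum S E (d + 1) j t} ≤
          bellmanMajorant (density E j k) A (lam - c) / 2 ^ j := by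
      intro c hc
      have hsub : {t ∈ dyadicIco j k | lam ≤ truncatedSum S E (d + 1) j t} ⊆
          {t ∈ dyadicIco (j + 1) (2 * k) | lam - c ≤ truncatedSum S E d (j + 1) t} ∪
          {t ∈ dyadicIco (j + 1) (2 * k + 1) | lam - c ≤ truncatedSum S E d (j + 1) t} := by
        rintro t ⟨ht, hl⟩
        rw [truncatedSum_succ, hc t ht] at hl
        rw [← dyadicIco_union] at ht
        exact ht.imp (fun h => ⟨h, by linarith⟩) (fun h => ⟨h, by linarith⟩)
      refine (measureReal_mono hsub (measure_ne_top_of_subset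
        (union_subset_union (sep_subset _ _) (sep_subset _ _))
        (by rw [dyadicIco_union]; exact volume_dyadicIco_ne_top _ _))).trans
        ((measureReal_union_le _ _).trans ((add_le_add (ih _ _ _) (ih _ _ _)).trans ?_))
      have h := bellmanMajorant_midpoint (lam := lam - c) (density_nonneg E (j + 1) (2 * k))
        (density_nonneg E (j + 1) (2 * k + 1)) (carlesonMass_nonneg S d (j + 1) (2 * k))
        (carlesonMass_nonneg S d (j + 1) (2 * k + 1))
      rw [← density_eq_average, ← hA] at h
      refine le_of_eq_of_le ?_ (div_le_div_of_nonneg_right h (show (0 : ℝ) ≤ 2 ^ j by positivity))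
      rw [pow_succ]
      field_simp
    have hle := carlesonMass_le_two hS (d + 1) j k
    rw [carlesonMass, ← hA] at hle ⊢
    by_cases hI : dyadicIco j k ∈ S
    · rw [if_pos hI] at hle ⊢
      refine (split (density E j k) ?_).trans ?_
      · intro t ht
        rw [sparseLayer, mem_dyadicIco.1 ht, if_pos hI]
      · rw [add_comm]
        -- The jump needs `A ≤ 1`, which holds because `1 + A` is itself a Carleson mass, hence at
        -- most `2`.
        exact div_le_div_of_nonneg_right (bellmanMajorant_jump (density_nonneg _ _ _)
          (density_le_one _ _ _) hA0 (by linarith)) (by positivity)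
    · rw [if_neg hI, zero_add]
      refine (split 0 ?_).trans (by rw [sub_zero])
      intro t ht
      rw [sparseLayer, mem_dyadicIco.1 ht, if_neg hI]

/-! ### The sparse operator -/

lemma setLAverage_indicator_dyadicIco {E : Set ℝ} (hE : MeasurableSet E) (j : ℕ) (k : ℤ) :
    ⨍⁻ s in dyadicIco j k, ‖E.indicator (fun _ => (1 : ℝ)) s‖ₑ ∂volume =
      ENNReal.ofReal (density E j k) := by
  have h : (fun s => ‖E.indicator (fun _ => (1 : ℝ)) s‖ₑ) = E.indicator 1 := by
    ext s
    by_cases hs : s ∈ E <;> simp [hs]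
  have hfin : volume (E ∩ dyadicIco j k) ≠ ⊤ :=
    measure_ne_top_of_subset inter_subset_right (volume_dyadicIco_ne_top j k)
  rw [setLAverage_eq, h, lintegral_indicator_one hE, Measure.restrict_apply hE, volume_dyadicIco,
    density, Measure.real, ← ENNReal.ofReal_toReal hfin,
    ← ENNReal.ofReal_div_of_pos (by positivity), ENNReal.ofReal_toReal hfin]
  congr 1
  field_simp

/-- Each point lies in exactly one dyadic interval of every generation, so the sum over `S` can be
regrouped by generation. -/
theorem sparseOperator_eq_tsum {S : Set (Set ℝ)} (hS : S ⊆ dyadicSubintervals (Ico (0 : ℝ) 1))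
    {E : Set ℝ} (hE : MeasurableSet E) (t : ℝ) :
    sparseOperator S (E.indicator fun _ => (1 : ℝ)) t =
      ∑' j, ENNReal.ofReal (sparseLayer S E j t) := by
  classical
  have h1 : ∀ J : S, (J : Set ℝ).indicator (fun _ => ⨍⁻ s in (J : Set ℝ),
      ‖E.indicator (fun _ => (1 : ℝ)) s‖ₑ ∂volume) t = ∑' j : ℕ,
        if (J : Set ℝ) = dyadicIco j ⌊t * 2 ^ j⌋ then
          ENNReal.ofReal (density E j ⌊t * 2 ^ j⌋) else 0 := by
    rintro ⟨J, hJ⟩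
    obtain ⟨i, k, rfl⟩ := exists_eq_dyadicIco (hS hJ)
    rw [tsum_eq_single i]
    · by_cases ht : t ∈ dyadicIco i k
      · rw [indicator_of_mem ht, mem_dyadicIco.1 ht, if_pos rfl]
        exact setLAverage_indicator_dyadicIco hE i k
      · rw [indicator_of_notMem ht, if_neg]
        exact fun h => ht (mem_dyadicIco.2 (dyadicIco_inj h).2.symm)
    · intro j hj
      rw [if_neg]
      exact fun h => hj (dyadicIco_inj h).1.symm
  unfold sparseOperator
  simp_rw [h1]
  rw [ENNReal.tsum_comm]
  congr 1 with j
  by_cases hI : dyadicIco j ⌊t * 2 ^ j⌋ ∈ S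
  · rw [tsum_eq_single ⟨_, hI⟩, if_pos rfl, sparseLayer, if_pos hI]
    intro J hJ
    rw [if_neg]
    exact fun h => hJ (Subtype.ext h)
  · rw [sparseLayer, if_neg hI, ENNReal.ofReal_zero, ENNReal.tsum_eq_zero]
    intro J
    rw [if_neg]
    exact fun h => hI (h ▸ J.2)

lemma ofReal_truncatedSum (S : Set (Set ℝ)) (E : Set ℝ) (d : ℕ) (t : ℝ) :
    ENNReal.ofReal (truncatedSum S E d 0 t) =
      ∑ j ∈ Finset.range d, ENNReal.ofReal (sparseLayer S E j t) := by
  rw [truncatedSum, ENNReal.ofReal_sum_of_nonneg fun _ _ => sparseLayer_nonneg _ _ _ _]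
  simp

lemma truncatedSum_mono (S : Set (Set ℝ)) (E : Set ℝ) (j : ℕ) (t : ℝ) :
    Monotone fun d => truncatedSum S E d j t := fun _ _ h =>
  Finset.sum_le_sum_of_subset_of_nonneg (Finset.range_mono h) fun _ _ _ => sparseLayer_nonneg _ _ _ _

theorem volume_sparseLevelSet_le {S : Set (Set ℝ)} {E : Set ℝ} {lam : ℝ}
    (hS : S ⊆ dyadicSubintervals (Ico (0 : ℝ) 1)) (hsp : IsSparse S) (hE : MeasurableSet E)
    (hE1 : E ⊆ Ico (0 : ℝ) 1) (hlam : 1 < lam) :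
    volume.real (sparseLevelSet S E lam) ≤
      volume.real E * (2 : ℝ) ^ (3 - volume.real E - lam) := by
  have hx : density E 0 0 = volume.real E := by
    rw [density, dyadicIco_zero_zero, inter_eq_left.2 hE1, pow_zero, mul_one]
  have hfin : ∀ s : Set ℝ, s ⊆ dyadicIco 0 0 → volume s ≠ ⊤ := fun s hs =>
    measure_ne_top_of_subset hs (volume_dyadicIco_ne_top 0 0)
  -- An infinite sum equal to `λ` may have all its partial sums below `λ`, so the level is first
  -- lowered to `μ < λ`; then `μ` tends to `λ`.
  have key : ∀ mu : ℝ, 1 < mu → mu < lam → volume.real (sparseLevelSet S E lam) ≤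
      volume.real E * (2 : ℝ) ^ (3 - volume.real E - mu) := by
    intro mu hmu1 hmu
    have hsub : sparseLevelSet S E lam ⊆
        ⋃ d, {t ∈ dyadicIco 0 0 | mu ≤ truncatedSum S E d 0 t} := by
      rintro t ⟨ht, hl⟩
      rw [sparseOperator_eq_tsum hS hE, ENNReal.tsum_eq_iSup_nat] at hl
      have : ENNReal.ofReal mu < ENNReal.ofReal lam :=
        (ENNReal.ofReal_lt_ofReal_iff (by linarith)).2 hmu
      obtain ⟨d, hd⟩ := lt_iSup_iff.1 (this.trans_le hl)
      rw [← ofReal_truncatedSum] at hd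
      exact mem_iUnion.2 ⟨d, dyadicIco_zero_zero ▸ ht,
        (ENNReal.ofReal_lt_ofReal_iff'.1 hd).1.le⟩
    have hmono : Monotone fun d => {t ∈ dyadicIco 0 0 | mu ≤ truncatedSum S E d 0 t} :=
      fun a b hab t ht => ⟨ht.1, ht.2.trans (truncatedSum_mono S E 0 t hab)⟩
    have hb : volume (⋃ d, {t ∈ dyadicIco 0 0 | mu ≤ truncatedSum S E d 0 t}) ≤
        ENNReal.ofReal (volume.real E * (2 : ℝ) ^ (3 - volume.real E - mu)) := by
      rw [hmono.measure_iUnion]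
      refine iSup_le fun d => ?_
      rw [← ENNReal.ofReal_toReal (hfin _ (sep_subset _ _))]
      refine ENNReal.ofReal_le_ofReal ((volume_truncatedSum_le hsp E d 0 0 mu).trans ?_)
      rw [pow_zero, div_one, ← hx]
      exact bellmanMajorant_le (density_nonneg _ _ _) (density_le_one _ _ _)
        (carlesonMass_nonneg _ _ _ _) (carlesonMass_le_two hsp _ _ _) hmu1
    exact ENNReal.toReal_le_of_le_ofReal (by positivity) ((measure_mono hsub).trans hb)
  have hcont : Filter.Tendsto (fun mu : ℝ => volume.real E * (2 : ℝ) ^ (3 - volume.real E - mu))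
      (nhdsWithin lam (Iio lam)) (nhds (volume.real E * (2 : ℝ) ^ (3 - volume.real E - lam))) := by
    refine (Continuous.tendsto ?_ lam).mono_left nhdsWithin_le_nhds
    exact continuous_const.mul ((Real.continuous_const_rpow two_ne_zero).comp (by fun_prop))
  refine ge_of_tendsto hcont ?_
  filter_upwards [Ioo_mem_nhdsLT hlam] with mu hmu using key mu hmu.1 hmu.2

/-! ### The extremal configuration -/

lemma isSparse_image {f G : ℕ → Set ℝ} {s : Set ℕ} (hinj : InjOn f s)
    (hf : ∀ i ∈ s, MeasurableSet (f i))
    (hG : ∀ i ∈ s, G i ⊆ f i ∧ MeasurableSet (G i) ∧ volume (f i) / 2 ≤ volume (G i))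
    (hd : s.PairwiseDisjoint G) : IsSparse (f '' s) := by
  have hinv : ∀ i ∈ s, Function.invFunOn f s (f i) = i := fun i hi => hinj.leftInvOn_invFunOn hi
  refine ⟨by rintro _ ⟨i, hi, rfl⟩; exact hf i hi, fun J => G (Function.invFunOn f s J), ?_, ?_⟩
  · rintro _ ⟨i, hi, rfl⟩
    simp only [hinv i hi]
    exact hG i hi
  · rintro _ ⟨i, hi, rfl⟩ _ ⟨j, hj, rfl⟩ hij
    simp only [Function.onFun, hinv i hi, hinv j hj]
    exact hd hi hj fun h => hij (h ▸ rfl)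

lemma dyadicIco_zero_anti {i j : ℕ} (h : i ≤ j) : dyadicIco j 0 ⊆ dyadicIco i 0 := by
  unfold dyadicIco
  norm_num
  refine Ico_subset_Ico_right ?_
  gcongr
  norm_num

lemma dyadicIco_half_le (j : ℕ) (k l : ℤ) :
    volume (dyadicIco j k) / 2 ≤ volume (dyadicIco (j + 1) l) := by
  rw [volume_dyadicIco, volume_dyadicIco, ← ENNReal.ofReal_ofNat 2,
    ← ENNReal.ofReal_div_of_pos two_pos, pow_succ, div_div]

lemma dyadicIco_left_subset (j : ℕ) (k : ℤ) : dyadicIco (j + 1) (2 * k) ⊆ dyadicIco j k :=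
  dyadicIco_union j k ▸ subset_union_left

lemma dyadicIco_right_subset (j : ℕ) (k : ℤ) : dyadicIco (j + 1) (2 * k + 1) ⊆ dyadicIco j k :=
  dyadicIco_union j k ▸ subset_union_right

/-- The intervals `[0, 2^{-i})`, `i ≤ m + 1`, followed by `[2^{-m-1}, 2^{-m})`. -/
def towerInterval (m i : ℕ) : Set ℝ := if i ≤ m + 1 then dyadicIco i 0 else dyadicIco (m + 1) 1

/-- Disjoint halves of the intervals `towerInterval m i`. -/
def towerHalf (m i : ℕ) : Set ℝ :=
  if i < m then dyadicIco (i + 1) 1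
  else if i = m then dyadicIco (m + 2) 1 ∪ dyadicIco (m + 2) 2
  else if i = m + 1 then dyadicIco (m + 2) 0 else dyadicIco (m + 2) 3

/-- The collection `{[0, 2^{-i}) : i ≤ m + 1} ∪ {[2^{-m-1}, 2^{-m})}`. -/
def tower (m : ℕ) : Set (Set ℝ) := towerInterval m '' Iic (m + 2)

lemma dyadicIco_mem_tower {m i : ℕ} (h : i ≤ m + 1) : dyadicIco i 0 ∈ tower m :=
  ⟨i, mem_Iic.2 (by omega), if_pos h⟩

lemma dyadicIco_one_mem_tower (m : ℕ) : dyadicIco (m + 1) 1 ∈ tower m :=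
  ⟨m + 2, mem_Iic.2 le_rfl, if_neg (by omega)⟩

lemma tower_subset (m : ℕ) : tower m ⊆ dyadicSubintervals (Ico (0 : ℝ) 1) := by
  rintro _ ⟨i, -, rfl⟩
  rw [← dyadicIco_zero_zero, towerInterval]
  split_ifs with h
  · exact ⟨isDyadicInterval_dyadicIco _ _, dyadicIco_zero_anti (Nat.zero_le _)⟩
  · exact ⟨isDyadicInterval_dyadicIco _ _,
      (dyadicIco_right_subset m 0).trans (dyadicIco_zero_anti (Nat.zero_le _))⟩

lemma towerHalf_subset_of_ge {m i : ℕ} (h : m ≤ i) : towerHalf m i ⊆ dyadicIco m 0 := by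
  have h0 := dyadicIco_left_subset m 0
  have h1 := dyadicIco_right_subset m 0
  have h00 := (dyadicIco_left_subset (m + 1) (2 * 0)).trans h0
  have h01 := (dyadicIco_right_subset (m + 1) (2 * 0)).trans h0
  have h10 := (dyadicIco_left_subset (m + 1) (2 * 0 + 1)).trans h1
  have h11 := (dyadicIco_right_subset (m + 1) (2 * 0 + 1)).trans h1
  unfold towerHalf
  rw [if_neg (by omega)]
  split_ifs
  exacts [union_subset h01 h10, h00, h11]

/-- For `i < m` the chosen half is the right one, and all later sets sit in the left one. Of the
four quarters of `[0, 2^{-m})`, the middle two serve that interval and the outer two serve its two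
children. -/
lemma pairwiseDisjoint_towerHalf (m : ℕ) : (Iic (m + 2)).PairwiseDisjoint (towerHalf m) := by
  have key : ∀ i j, i < j → j ≤ m + 2 → Disjoint (towerHalf m i) (towerHalf m j) := by
    intro i j hij hj
    rcases lt_or_ge i m with hi | hi
    · have hsub : towerHalf m j ⊆ dyadicIco (i + 1) 0 := by
        rcases lt_or_ge j m with hjm | hjm
        · rw [towerHalf, if_pos hjm]
          exact (dyadicIco_right_subset j 0).trans (dyadicIco_zero_anti hij)
        · exact (towerHalf_subset_of_ge hjm).trans (dyadicIco_zero_anti hi)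
      rw [towerHalf, if_pos hi]
      exact (disjoint_dyadicIco one_ne_zero).mono_right hsub
    · have hd : ∀ k l : ℤ, k ≠ l → Disjoint (dyadicIco (m + 2) k) (dyadicIco (m + 2) l) :=
        fun k l => disjoint_dyadicIco
      unfold towerHalf
      rw [if_neg (show ¬ i < m by omega), if_neg (show ¬ j < m by omega),
        if_neg (show j ≠ m by omega)]
      split_ifs with h1 h2 h3
      · exact (hd _ _ (by norm_num)).union_left (hd _ _ (by norm_num))
      · exact (hd _ _ (by norm_num)).union_left (hd _ _ (by norm_num))
      · omega
      · exact hd _ _ (by norm_num)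
      · omega
      · omega
  intro i hi j hj hij
  rcases lt_or_gt_of_ne hij with h | h
  · exact key i j h hj
  · exact (key j i h hi).symm

lemma isSparse_tower (m : ℕ) : IsSparse (tower m) := by
  refine isSparse_image (G := towerHalf m) ?_ ?_ ?_ (pairwiseDisjoint_towerHalf m)
  · intro i hi j hj h
    rw [mem_Iic] at hi hj
    unfold towerInterval at h
    split_ifs at h with h1 h2 h3
    · exact (dyadicIco_inj h).1
    · exact absurd (dyadicIco_inj h).2 (by norm_num)
    · exact absurd (dyadicIco_inj h).2 (by norm_num)
    · omega
  · intro i _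
    unfold towerInterval
    split_ifs <;> exact measurableSet_dyadicIco _ _
  · intro i hi
    rw [mem_Iic] at hi
    refine ⟨?_, ?_, ?_⟩
    · rcases lt_or_ge i m with him | him
      · rw [towerHalf, if_pos him, towerInterval, if_pos (by omega)]
        exact dyadicIco_right_subset i 0
      · rcases him.eq_or_lt with rfl | him'
        · rw [towerInterval, if_pos (by omega)]
          exact towerHalf_subset_of_ge le_rfl
        · unfold towerHalf towerInterval
          rw [if_neg (by omega), if_neg (by omega)]
          split_ifs with h1 h2
          · subst h1
            exact dyadicIco_left_subset (m + 1) 0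
          · omega
          · omega
          · exact dyadicIco_right_subset (m + 1) 1
    · unfold towerHalf
      split_ifs
      exacts [measurableSet_dyadicIco _ _,
        (measurableSet_dyadicIco _ _).union (measurableSet_dyadicIco _ _),
        measurableSet_dyadicIco _ _, measurableSet_dyadicIco _ _]
    · unfold towerHalf towerInterval
      split_ifs with h1 h2 h3 h4 h5 h6 h7
      any_goals omega
      · exact dyadicIco_half_le _ _ _
      · subst h3
        rw [measure_union (disjoint_dyadicIco (by norm_num)) (measurableSet_dyadicIco _ _)]
        refine (dyadicIco_half_le i 0 0).trans ?_
        refine (ENNReal.add_halves _).symm.le.trans (add_le_add ?_ ?_) <;>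
          exact dyadicIco_half_le _ _ _
      · subst h4
        exact dyadicIco_half_le _ _ _
      · exact dyadicIco_half_le _ _ _

lemma density_eq_one {E : Set ℝ} {j : ℕ} {k : ℤ} (h : dyadicIco j k ⊆ E) : density E j k = 1 := by
  rw [density, inter_eq_right.2 h, volume_real_dyadicIco, one_div, inv_mul_cancel₀ (by positivity)]

lemma density_dyadicIco_of_le {n j : ℕ} (h : j ≤ n) :
    density (dyadicIco n 0) j 0 = 2 ^ j / 2 ^ n := by
  rw [density, inter_eq_left.2 (dyadicIco_zero_anti h), volume_real_dyadicIco]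
  ring

lemma sparseLayer_tower {m j : ℕ} (h : j ≤ m) (E : Set ℝ) {t : ℝ} (ht : t ∈ dyadicIco m 0) :
    sparseLayer (tower m) E j t = density E j 0 := by
  rw [sparseLayer, mem_dyadicIco.1 (dyadicIco_zero_anti h ht),
    if_pos (dyadicIco_mem_tower (by omega))]

/-- Both children of `[0, 2^{-m})` belong to the tower, so the last generation still contributes on
all of `[0, 2^{-m})`. -/
lemma sparseLayer_tower_succ {m n : ℕ} (h : n ≤ m) {t : ℝ} (ht : t ∈ dyadicIco m 0) :
    sparseLayer (tower m) (dyadicIco n 0) (m + 1) t = 1 := by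
  have hsub := dyadicIco_zero_anti h
  have h0 := (dyadicIco_left_subset m 0).trans hsub
  have h1 := (dyadicIco_right_subset m 0).trans hsub
  rw [← dyadicIco_union] at ht
  rw [mul_zero] at h0 h1 ht
  rw [zero_add] at h1 ht
  rcases ht with ht | ht
  · rw [sparseLayer, mem_dyadicIco.1 ht, if_pos (dyadicIco_mem_tower le_rfl), density_eq_one h0]
  · rw [sparseLayer, mem_dyadicIco.1 ht, if_pos (dyadicIco_one_mem_tower m), density_eq_one h1]

lemma truncatedSum_tower (n k : ℕ) {t : ℝ} (ht : t ∈ dyadicIco (n + k) 0) :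
    truncatedSum (tower (n + k)) (dyadicIco n 0) (n + (k + 2)) 0 t = k + 3 - 1 / 2 ^ n := by
  have h1 : ∑ i ∈ Finset.range n, sparseLayer (tower (n + k)) (dyadicIco n 0) (0 + i) t =
      1 - 1 / 2 ^ n := by
    have : ∀ i ∈ Finset.range n, sparseLayer (tower (n + k)) (dyadicIco n 0) (0 + i) t =
        2 ^ i / 2 ^ n := by
      intro i hi
      rw [Finset.mem_range] at hi
      rw [zero_add, sparseLayer_tower (by omega) _ ht, density_dyadicIco_of_le hi.le]
    rw [Finset.sum_congr rfl this, ← Finset.sum_div, geom_sum_eq (by norm_num)]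
    field_simp
    norm_num
  -- Generations `n, …, n + k` of the tower, and the pair of children in generation `n + k + 1`, all
  -- lie inside `E`.
  have h2 : ∀ i ∈ Finset.range (k + 2),
      sparseLayer (tower (n + k)) (dyadicIco n 0) (0 + (n + i)) t = 1 := by
    intro i hi
    rw [Finset.mem_range] at hi
    rw [zero_add]
    rcases Nat.lt_or_ge k i with h | h
    · rw [show n + i = n + k + 1 by omega]
      exact sparseLayer_tower_succ (by omega) ht
    · rw [sparseLayer_tower (by omega) _ ht]
      exact density_eq_one (dyadicIco_zero_anti (by omega))
  rw [truncatedSum, Finset.sum_range_add, h1, Finset.sum_congr rfl h2]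
  simp
  ring

lemma subset_sparseLevelSet_tower (n k : ℕ) : dyadicIco (n + k) 0 ⊆
    sparseLevelSet (tower (n + k)) (dyadicIco n 0) (k + 3 - 1 / 2 ^ n) := by
  intro t ht
  refine ⟨dyadicIco_zero_zero ▸ dyadicIco_zero_anti (Nat.zero_le _) ht, ?_⟩
  rw [sparseOperator_eq_tsum (tower_subset _) (measurableSet_dyadicIco _ _),
    ← truncatedSum_tower n k ht, ofReal_truncatedSum]
  exact ENNReal.sum_le_tsum _

theorem mainTheorem2 (n : ℕ) (lam : ℝ)
    (hlam : ∃ N : ℕ, lam = (N : ℝ) - (2 : ℝ) ^ (-(n : ℝ))) (hlam2 : 2 ≤ lam) :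
    (∀ (S : Set (Set ℝ)) (E : Set ℝ),
        S ⊆ dyadicSubintervals (Ico (0 : ℝ) 1) → IsSparse S →
        MeasurableSet E → E ⊆ Ico (0 : ℝ) 1 → volume.real E = (2 : ℝ) ^ (-(n : ℝ)) →
        volume.real (sparseLevelSet S E lam) ≤
          volume.real E * (2 : ℝ) ^ (3 - volume.real E - lam)) ∧
    (∃ (S : Set (Set ℝ)) (E : Set ℝ),
        S ⊆ dyadicSubintervals (Ico (0 : ℝ) 1) ∧ IsSparse S ∧
        MeasurableSet E ∧ E ⊆ Ico (0 : ℝ) 1 ∧ volume.real E = (2 : ℝ) ^ (-(n : ℝ)) ∧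
        volume.real (sparseLevelSet S E lam) =
          volume.real E * (2 : ℝ) ^ (3 - volume.real E - lam)) := by
  refine ⟨fun S E hS hsp hE hE1 _ => volume_sparseLevelSet_le hS hsp hE hE1 (by linarith), ?_⟩
  have hpow : (2 : ℝ) ^ (-(n : ℝ)) = 1 / 2 ^ n := by
    rw [Real.rpow_neg two_pos.le, Real.rpow_natCast, one_div]
  obtain ⟨N, hN⟩ := hlam
  have hpos : (0 : ℝ) < 2 ^ (-(n : ℝ)) := by positivity
  -- Since `λ ≥ 2` and `2^{-n} > 0`, `N ≥ 3`; writing `N = 3 + k` fixes the tower height `n + k`.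
  have hN3 : 2 < N := by
    have : (2 : ℝ) < N := by linarith
    exact_mod_cast this
  obtain ⟨k, rfl⟩ := Nat.exists_eq_add_of_le hN3
  have hlamk : lam = k + 3 - 1 / 2 ^ n := by
    rw [hN, hpow]
    push_cast
    ring
  have hvE : volume.real (dyadicIco n 0) = (2 : ℝ) ^ (-(n : ℝ)) := by
    rw [volume_real_dyadicIco, hpow]
  have hE1 : dyadicIco n 0 ⊆ Ico (0 : ℝ) 1 :=
    dyadicIco_zero_zero ▸ dyadicIco_zero_anti (Nat.zero_le n)
  refine ⟨tower (n + k), dyadicIco n 0, tower_subset _, isSparse_tower _,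
    measurableSet_dyadicIco _ _, hE1, hvE, le_antisymm
      (volume_sparseLevelSet_le (tower_subset _) (isSparse_tower _) (measurableSet_dyadicIco _ _)
        hE1 (by linarith)) ?_⟩
  -- Containing `[0, 2^{-n-k})` is enough: its length is already the upper bound.
  have h := measureReal_mono (μ := volume) (subset_sparseLevelSet_tower n k)
    (measure_ne_top_of_subset (fun t ht => ht.1)
      (dyadicIco_zero_zero ▸ volume_dyadicIco_ne_top 0 0))
  rw [hlamk, hvE, hpow]
  refine le_of_eq_of_le ?_ h
  rw [volume_real_dyadicIco, pow_add,
    show (3 : ℝ) - 1 / 2 ^ n - (k + 3 - 1 / 2 ^ n) = -(k : ℝ) by ring,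
    Real.rpow_neg two_pos.le, Real.rpow_natCast]
  field_simp
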